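/- All graphs are finite and simple. A cut vertex of a graph is a vertex that separates two other vertices of the same component. A block of a graph is a maximal connected subgraph that has no cut vertex of its own (an isolated vertex is a block). For a graph $H$, let $B(H)$ be the intersection graph of the blocks of $H$; a block graph is a graph isomorphic to $B(H)$ for some graph $H$. The weighted block tree $\mathrm{bcw}(G)$ of a connected graph $G$ has as vertices the cut vertices and the blocks of $G$, a cut vertex being adjacent to exactly the blocks that contain it; each cut vertex has weight $1$ and each block has as weight its number of vertices that are not cut vertices of $G$. A weighted block tree is a weighted tree $(T,w)$ that is isomorphic, by a bijection preserving adjacency and weights, to $\mathrm{bcw}(H)$ for some connected graph $H$. Call a vertex of a tree a leaf if its degree is at most $1$, and a block vertex if it is at even distance from some leaf. Theorem. For every $n\ge 0$ the map $G\mapsto \mathrm{bcw}(G)$ induces a bijection from the isomorphism classes of connected block graphs on $n$ vertices to the isomorphism classes of weighted block trees of total weight $n$. The inverse sends $(T,w)$ to the graph obtained as follows: for each block vertex $B$ of $T$ take a clique on $w(B)+\deg_T(B)$ vertices, the cliques being disjoint, and choose in it distinct vertices, one for each neighbour of $B$ in $T$; then, for every vertex $v$ of $T$ that is not a block vertex,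 identify all the vertices chosen for $v$. Up to isomorphism the result does not depend on the choices. Moreover, a pair $(T,w)$ of a graph $T$ and a function $w:V(T)\to\mathbb{Z}_{\ge 0}$ is a weighted block tree if and only if $T$ is a tree, any two leaves of $T$ are at even distance, every vertex that is not a block vertex has weight $1$, and every leaf has weight at least $1$. -/

import Mathlib

namespace BlockGraphs

/-- `v` is a cut vertex of `G`: it separates two other vertices of one connected component. -/
def IsCutVertex {V : Type*} (G : SimpleGraph V) (v : V) : Prop :=
  ∃ x y : V, x ≠ v ∧ y ≠ v ∧ G.Reachable x y ∧ ∀ p : G.Walk x y, v ∈ p.support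

/-- The subgraph induced by `S` is connected (in particular nonempty) and has no cut vertex of
its own. -/
def IsNonseparable {V : Type*} (G : SimpleGraph V) (S : Set V) : Prop :=
  (G.induce S).Connected ∧ ∀ v : S, ¬ IsCutVertex (G.induce S) v

/-- A block is a maximal connected subgraph without a cut vertex. Such a subgraph is induced, so
it is given by its vertex set. The only block of a one-vertex component is the component. -/
def IsBlock {V : Type*} (G : SimpleGraph V) (S : Set V) : Prop :=
  Maximal (IsNonseparable G) S

/-- The graph `B(H)`: the intersection graph of the blocks of `H`. -/
def blockIntersectionGraph {V : Type*} (H : SimpleGraph V) :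
    SimpleGraph {S : Set V // IsBlock H S} where
  Adj A B := A ≠ B ∧ (A.1 ∩ B.1).Nonempty
  symm := ⟨fun A B h => ⟨h.1.symm, Set.inter_comm A.1 B.1 ▸ h.2⟩⟩
  loopless := ⟨fun _ h => h.1 rfl⟩

/-- `G` is a block graph: it is isomorphic to `B(H)` for some finite graph `H`. -/
def IsBlockGraph {V : Type*} (G : SimpleGraph V) : Prop :=
  ∃ (k : ℕ) (H : SimpleGraph (Fin k)), Nonempty (G ≃g blockIntersectionGraph H)

/-- The vertices of the block tree of `G`: the cut vertices and the blocks of `G`. -/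
abbrev BlockTreeVertex {V : Type*} (G : SimpleGraph V) : Type _ :=
  {v : V // IsCutVertex G v} ⊕ {S : Set V // IsBlock G S}

/-- The block tree of `G`: a cut vertex is adjacent to exactly the blocks that contain it. -/
def blockTree {V : Type*} (G : SimpleGraph V) : SimpleGraph (BlockTreeVertex G) where
  Adj
    | Sum.inl v, Sum.inr B => v.1 ∈ B.1
    | Sum.inr B, Sum.inl v => v.1 ∈ B.1
    | _, _ => False
  symm := ⟨by rintro (a | a) (b | b) h <;> exact h⟩
  loopless := ⟨by rintro (a | a) h <;> exact h⟩

/-- Cut vertices have weight `1`; the weight of a block is its number of non-cut vertices. -/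
noncomputable def blockTreeWeight {V : Type*} (G : SimpleGraph V) : BlockTreeVertex G → ℕ
  | Sum.inl _ => 1
  | Sum.inr B => {v : V | v ∈ B.1 ∧ ¬ IsCutVertex G v}.ncard

/-- Isomorphism of vertex-weighted graphs. -/
def WeightedIso {V W : Type*} (T : SimpleGraph V) (w : V → ℕ) (T' : SimpleGraph W) (w' : W → ℕ) :
    Prop :=
  ∃ f : T ≃g T', ∀ v, w' (f v) = w v

/-- `(T, w)` is a weighted block tree: a tree that is, as a weighted graph, the weighted block tree
of some finite connected graph (which need not be a block graph). -/
def IsWeightedBlockTree {V : Type*} (T : SimpleGraph V) (w : V → ℕ) : Prop :=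
  T.IsTree ∧ ∃ (k : ℕ) (H : SimpleGraph (Fin k)), H.Connected ∧
    WeightedIso (blockTree H) (blockTreeWeight H) T w

/-- Vertices of degree at most one; the vertex of a one-vertex tree counts as a leaf. -/
def IsLeaf {V : Type*} (T : SimpleGraph V) (v : V) : Prop :=
  (T.neighborSet v).Subsingleton

/-- The vertices of a tree that must correspond to blocks: those at even distance from a leaf. -/
def IsBlockVertex {V : Type*} (T : SimpleGraph V) (v : V) : Prop :=
  ∃ l : V, IsLeaf T l ∧ Even (T.dist v l)

/-- The cliques, before gluing, built from `(T, w)`: one on `w(B) + deg(B)` vertices for each block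
vertex `B`. -/
abbrev CliqueVertex {V : Type*} (T : SimpleGraph V) (w : V → ℕ) : Type _ :=
  Σ B : {B : V // IsBlockVertex T B}, Fin (w B.1 + (T.neighborSet B.1).ncard)

/-- For each block vertex `B`, a choice of distinct vertices of the clique of `B`, one for each
neighbour of `B` in `T`. -/
abbrev GluingChoice {V : Type*} (T : SimpleGraph V) (w : V → ℕ) : Type _ :=
  ∀ B : {B : V // IsBlockVertex T B},
    T.neighborSet B.1 ↪ Fin (w B.1 + (T.neighborSet B.1).ncard)

/-- Two clique vertices are identified if they were chosen for the same vertex `v` of `T`. -/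
def Glued {V : Type*} {T : SimpleGraph V} {w : V → ℕ} (e : GluingChoice T w)
    (x y : CliqueVertex T w) : Prop :=
  ∃ (v : V) (hx : T.Adj x.1.1 v) (hy : T.Adj y.1.1 v),
    x.2 = e x.1 ⟨v, hx⟩ ∧ y.2 = e y.1 ⟨v, hy⟩

/-- The graph obtained from the disjoint cliques by performing the identifications. -/
def gluedGraph {V : Type*} {T : SimpleGraph V} {w : V → ℕ} (e : GluingChoice T w) :
    SimpleGraph (Quot (Glued e)) where
  Adj x y := x ≠ y ∧ ∃ (B : {B : V // IsBlockVertex T B})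
    (i j : Fin (w B.1 + (T.neighborSet B.1).ncard)),
      x = Quot.mk (Glued e) ⟨B, i⟩ ∧ y = Quot.mk (Glued e) ⟨B, j⟩
  symm := ⟨fun _ _ ⟨h, B, i, j, hi, hj⟩ => ⟨h.symm, B, j, i, hj, hi⟩⟩
  loopless := ⟨fun _ h => h.1 rfl⟩

/-- Connected block graphs on the vertex set `Fin n`. -/
structure ConnectedBlockGraph (n : ℕ) where
  graph : SimpleGraph (Fin n)
  connected : graph.Connected
  isBlockGraph : IsBlockGraph graph

/-- Weighted block trees of total weight `n`, on a vertex set `Fin m` for any `m`. -/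
structure WeightedBlockTree (n : ℕ) where
  m : ℕ
  tree : SimpleGraph (Fin m)
  weight : Fin m → ℕ
  isWeightedBlockTree : IsWeightedBlockTree tree weight
  total : ∑ v, weight v = n

instance ConnectedBlockGraph.setoid (n : ℕ) : Setoid (ConnectedBlockGraph n) where
  r G G' := Nonempty (G.graph ≃g G'.graph)
  iseqv := ⟨fun _ => ⟨SimpleGraph.Iso.refl⟩, fun ⟨f⟩ => ⟨f.symm⟩, fun ⟨f⟩ ⟨g⟩ => ⟨f.trans g⟩⟩

instance WeightedBlockTree.setoid (n : ℕ) : Setoid (WeightedBlockTree n) where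
  r T T' := WeightedIso T.tree T.weight T'.tree T'.weight
  iseqv := ⟨fun _ => ⟨SimpleGraph.Iso.refl, fun _ => rfl⟩,
    fun ⟨f, hf⟩ => ⟨f.symm, fun v => by rw [← hf (f.symm v), f.apply_symm_apply]⟩,
    fun ⟨f, hf⟩ ⟨g, hg⟩ => ⟨f.trans g, fun v => by
      rw [← hf v, ← hg (f v)]; rfl⟩⟩

/-- Isomorphism classes of connected block graphs on `n` vertices. -/
abbrev ConnectedBlockGraphClass (n : ℕ) : Type :=
  Quotient (ConnectedBlockGraph.setoid n)

/-- Isomorphism classes of weighted block trees of total weight `n`. -/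
abbrev WeightedBlockTreeClass (n : ℕ) : Type :=
  Quotient (WeightedBlockTree.setoid n)

end BlockGraphs

/-!
Put the vertices of a graph on the vertices of a tree `T`, a vertex that belongs to two bags on the
tree vertex between them, so that the graph becomes the union of the cliques on the bags, the bag of
a block vertex consisting of the vertices placed on it or next to it. Since `T` has no cycle, two
bags share at most one vertex and this vertex separates them. Hence a connected subgraph without a
cut vertex stays in one bag, the bags are exactly the blocks, and the tree and its weights are those
of the block tree. Conversely the tree and the number of vertices placed on each of its vertices
determine the graph, and gluing the cliques constructs it.

The same argument, applied to the incidence forest of the vertices and the blocks of `H`, shows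
that the blocks of `B(H)` are cliques: the bags are the sets of blocks through a vertex. If the
blocks of a graph `G` are cliques, then placing one vertex on each vertex of that forest for `G`
gives a graph `H` with `B(H)` isomorphic to `G`.
-/

namespace BlockGraphs

/-- `x` and `y` are joined by a walk of `G` that stays in `S`. Unlike reachability in `G.induce S`,
this is stated for vertices of `G`, so that `S` can vary without moving between subtypes. -/
def ReachableIn {V : Type*} (G : SimpleGraph V) (S : Set V) (x y : V) : Prop :=
  ∃ p : G.Walk x y, ∀ z ∈ p.support, z ∈ S

section ReachableIn

variable {V W : Type*} {G : SimpleGraph V} {S S' : Set V} {x y z v : V}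

theorem ReachableIn.refl (hx : x ∈ S) : ReachableIn G S x x :=
  ⟨.nil, by simpa using hx⟩

theorem ReachableIn.symm (h : ReachableIn G S x y) : ReachableIn G S y x := by
  obtain ⟨p, hp⟩ := h
  exact ⟨p.reverse, by simpa using hp⟩

theorem ReachableIn.trans (h : ReachableIn G S x y) (h' : ReachableIn G S y z) :
    ReachableIn G S x z := by
  obtain ⟨p, hp⟩ := h
  obtain ⟨q, hq⟩ := h'
  refine ⟨p.append q, fun a ha => ?_⟩
  rw [SimpleGraph.Walk.mem_support_append_iff] at ha
  exact ha.elim (hp a) (hq a)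

theorem ReachableIn.mono (hS : S ⊆ S') (h : ReachableIn G S x y) : ReachableIn G S' x y := by
  obtain ⟨p, hp⟩ := h
  exact ⟨p, fun a ha => hS (hp a ha)⟩

theorem ReachableIn.of_adj (h : G.Adj x y) (hx : x ∈ S) (hy : y ∈ S) : ReachableIn G S x y :=
  ⟨h.toWalk, by simp [hx, hy]⟩

theorem ReachableIn.left_mem (h : ReachableIn G S x y) : x ∈ S := by
  obtain ⟨p, hp⟩ := h
  exact hp x p.start_mem_support

theorem ReachableIn.right_mem (h : ReachableIn G S x y) : y ∈ S :=
  h.symm.left_mem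

theorem ReachableIn.reachable (h : ReachableIn G S x y) : G.Reachable x y :=
  ⟨h.choose⟩

theorem ReachableIn.induction_on {P : V → Prop} (h : ReachableIn G S x y) (hx : P x)
    (step : ∀ a ∈ S, ∀ b ∈ S, G.Adj a b → P a → P b) : P y := by
  obtain ⟨p, hp⟩ := h
  induction p with
  | nil => exact hx
  | cons hadj p ih =>
    simp only [SimpleGraph.Walk.support_cons, List.mem_cons, forall_eq_or_imp] at hp
    exact ih (step _ hp.1 _ (hp.2 _ p.start_mem_support) hadj hx) hp.2

theorem ReachableIn.map {G' : SimpleGraph W} {R : Set W} {f : V → W} (h : ReachableIn G S x y)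
    (hx : f x ∈ R)
    (step : ∀ a ∈ S, ∀ b ∈ S, G.Adj a b → f a ∈ R → ReachableIn G' R (f a) (f b)) :
    ReachableIn G' R (f x) (f y) :=
  h.induction_on (P := fun a => ReachableIn G' R (f x) (f a)) (.refl hx)
    fun a ha b hb hab h => h.trans (step a ha b hb hab h.right_mem)

theorem reachable_induce_iff {a b : S} : (G.induce S).Reachable a b ↔ ReachableIn G S a b := by
  constructor
  · rintro ⟨p⟩
    refine ⟨p.map (SimpleGraph.Embedding.induce S).toHom, fun z hz => ?_⟩
    obtain ⟨c, -, rfl⟩ := List.mem_map.1 (SimpleGraph.Walk.support_map _ p ▸ hz)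
    exact c.2
  · rintro ⟨p, hp⟩
    exact ⟨p.induce S hp⟩

theorem exists_walk_induce_notMem_support_iff {v a b : S} :
    (∃ p : (G.induce S).Walk a b, v ∉ p.support) ↔ ReachableIn G (S \ {v.1}) a b := by
  constructor
  · rintro ⟨p, hv⟩
    refine ⟨p.map (SimpleGraph.Embedding.induce S).toHom, fun z hz => ?_⟩
    obtain ⟨c, hc, rfl⟩ := List.mem_map.1 (SimpleGraph.Walk.support_map _ p ▸ hz)
    exact ⟨c.2, fun h => hv (Subtype.ext (show c.1 = v.1 from h) ▸ hc)⟩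
  · rintro ⟨p, hp⟩
    refine ⟨p.induce S fun z hz => (hp z hz).1, fun hv => ?_⟩
    rw [SimpleGraph.Walk.support_induce] at hv
    exact (hp v.1 (by simpa using hv)).2 rfl

theorem exists_adj_reachableIn_compl (p : G.Walk x v) (hx : x ≠ v) :
    ∃ a, G.Adj a v ∧ ReachableIn G {v}ᶜ x a := by
  induction p with
  | nil => exact absurd rfl hx
  | @cons u b w h p ih =>
    by_cases hb : b = w
    · subst hb
      exact ⟨u, h, .refl hx⟩
    · obtain ⟨a, ha, hc⟩ := ih hb
      exact ⟨a, ha, (ReachableIn.of_adj h hx hb).trans hc⟩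

theorem reachableIn_end_of_isPath {p : G.Walk y z} (hp : p.IsPath) (hx : x ∈ p.support) {D : Set V}
    (hD : D.Subsingleton) (hxD : x ∉ D) :
    ReachableIn G ({a | a ∈ p.support} \ D) x y ∨ ReachableIn G ({a | a ∈ p.support} \ D) x z := by
  obtain ⟨q, r, rfl⟩ := SimpleGraph.Walk.mem_support_iff_exists_append.1 hx
  by_cases h : ∃ d ∈ D, d ∈ q.support
  · obtain ⟨d, hdD, hdq⟩ := h
    refine .inr ⟨r, fun a ha => ⟨SimpleGraph.Walk.mem_support_append_iff _ _ |>.2 (.inr ha),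
      fun haD => ?_⟩⟩
    exact hp.ne_of_mem_support_of_append (fun h => hxD (h ▸ haD)) hdq ha (hD hdD haD)
  · push Not at h
    exact .inl (ReachableIn.symm ⟨q, fun a ha =>
      ⟨SimpleGraph.Walk.mem_support_append_iff _ _ |>.2 (.inl ha), fun haD => h a haD ha⟩⟩)

end ReachableIn

section Nonseparable

variable {V : Type*} {G : SimpleGraph V} {S B B' D : Set V} {x y z v : V}

theorem isCutVertex_iff :
    IsCutVertex G v ↔ ∃ x y, x ≠ v ∧ y ≠ v ∧ G.Reachable x y ∧ ¬ ReachableIn G {v}ᶜ x y := by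
  unfold IsCutVertex ReachableIn
  refine exists₂_congr fun x y => and_congr_right fun _ => and_congr_right fun _ =>
    and_congr_right fun _ => ?_
  push Not
  exact forall_congr' fun p => by simp

/-- Deleting at most one vertex, rather than exactly one, treats connectedness and the absence of
cut vertices as one condition. -/
theorem isNonseparable_iff :
    IsNonseparable G S ↔ S.Nonempty ∧
      ∀ D : Set V, D.Subsingleton → ∀ x ∈ S \ D, ∀ y ∈ S \ D, ReachableIn G (S \ D) x y := by
  constructor
  · rintro ⟨hconn, hcut⟩
    refine ⟨Set.nonempty_coe_sort.1 hconn.nonempty, fun D hD x hx y hy => ?_⟩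
    by_cases hDS : ∃ u ∈ D, u ∈ S
    · obtain ⟨u, huD, huS⟩ := hDS
      obtain rfl : D = {u} := hD.eq_singleton_of_mem huD
      have havoid := hcut ⟨u, huS⟩
      simp only [IsCutVertex] at havoid
      push Not at havoid
      exact exists_walk_induce_notMem_support_iff.1 (havoid ⟨x, hx.1⟩ ⟨y, hy.1⟩
        (fun e => hx.2 (congrArg Subtype.val e)) (fun e => hy.2 (congrArg Subtype.val e))
        (hconn.preconnected _ _))
    · push Not at hDS
      exact (reachable_induce_iff.1 (hconn.preconnected ⟨x, hx.1⟩ ⟨y, hy.1⟩)).mono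
        fun a ha => ⟨ha, fun h => hDS a h ha⟩
  · rintro ⟨hne, h⟩
    have : Nonempty S := hne.to_subtype
    refine ⟨⟨fun a b => reachable_induce_iff.2 ?_⟩, ?_⟩
    · exact (h ∅ Set.subsingleton_empty a ⟨a.2, id⟩ b ⟨b.2, id⟩).mono Set.sdiff_subset
    · rintro v ⟨a, b, ha, hb, -, hp⟩
      obtain ⟨p, hv⟩ := exists_walk_induce_notMem_support_iff.2
        (h {v.1} Set.subsingleton_singleton a ⟨a.2, fun e => ha (Subtype.ext e)⟩ b
          ⟨b.2, fun e => hb (Subtype.ext e)⟩)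
      exact hv (hp p)

theorem IsNonseparable.nonempty (h : IsNonseparable G S) : S.Nonempty :=
  (isNonseparable_iff.1 h).1

theorem IsNonseparable.reachableIn_sdiff (h : IsNonseparable G S) (hD : D.Subsingleton)
    (hx : x ∈ S) (hxD : x ∉ D) (hy : y ∈ S) (hyD : y ∉ D) : ReachableIn G (S \ D) x y :=
  (isNonseparable_iff.1 h).2 D hD x ⟨hx, hxD⟩ y ⟨hy, hyD⟩

theorem IsNonseparable.reachableIn (h : IsNonseparable G S) (hx : x ∈ S) (hy : y ∈ S) :
    ReachableIn G S x y :=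
  (h.reachableIn_sdiff Set.subsingleton_empty hx id hy id).mono Set.sdiff_subset

theorem IsNonseparable.reachableIn_compl (h : IsNonseparable G S)
    (hx : x ∈ S) (hxv : x ≠ v) (hy : y ∈ S) (hyv : y ≠ v) : ReachableIn G {v}ᶜ x y :=
  (h.reachableIn_sdiff Set.subsingleton_singleton hx hxv hy hyv).mono fun _ h => h.2

theorem IsNonseparable.exists_adj (h : IsNonseparable G S) (hx : x ∈ S) (hy : y ∈ S)
    (hne : x ≠ y) : ∃ a ∈ S, G.Adj x a := by
  obtain ⟨p, hp⟩ := h.reachableIn hx hy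
  cases p with
  | nil => exact absurd rfl hne
  | cons hadj p => exact ⟨_, hp _ (by simp), hadj⟩

theorem isNonseparable_of_isClique (hne : S.Nonempty) (h : G.IsClique S) : IsNonseparable G S := by
  refine isNonseparable_iff.2 ⟨hne, fun D _ x hx y hy => ?_⟩
  by_cases hxy : x = y
  · subst hxy
    exact .refl hx
  · exact .of_adj (h hx.1 hy.1 hxy) hx hy

theorem IsNonseparable.of_subset (hB : IsNonseparable G B) (hBS : B ⊆ S)
    (h : ∀ D : Set V, D.Subsingleton → ∀ x ∈ S \ D, ∃ b ∈ B, ReachableIn G (S \ D) x b) :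
    IsNonseparable G S := by
  refine isNonseparable_iff.2 ⟨hB.nonempty.mono hBS, fun D hD x hx y hy => ?_⟩
  obtain ⟨b, hb, hxb⟩ := h D hD x hx
  obtain ⟨b', hb', hyb'⟩ := h D hD y hy
  exact hxb.trans (((hB.reachableIn_sdiff hD hb hxb.right_mem.2 hb' hyb'.right_mem.2).mono
    (Set.sdiff_subset_sdiff_left hBS)).trans hyb'.symm)

theorem IsNonseparable.union (hB : IsNonseparable G B) (hB' : IsNonseparable G B')
    (h : (B ∩ B').Nontrivial) : IsNonseparable G (B ∪ B') := by
  refine hB.of_subset Set.subset_union_left fun D hD x hx => ?_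
  obtain ⟨b, hb, hbD⟩ := Set.not_subset.1 fun hsub => h.not_subsingleton (hD.anti hsub)
  refine ⟨b, hb.1, hx.1.elim (fun hxB => ?_) fun hxB' => ?_⟩
  · exact (hB.reachableIn_sdiff hD hxB hx.2 hb.1 hbD).mono
      (Set.sdiff_subset_sdiff_left Set.subset_union_left)
  · exact (hB'.reachableIn_sdiff hD hxB' hx.2 hb.2 hbD).mono
      (Set.sdiff_subset_sdiff_left Set.subset_union_right)

theorem IsNonseparable.union_support_of_isPath (hB : IsNonseparable G B) {p : G.Walk y z}
    (hp : p.IsPath) (hy : y ∈ B) (hz : z ∈ B) : IsNonseparable G (B ∪ {a | a ∈ p.support}) := by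
  refine hB.of_subset Set.subset_union_left fun D hD x hx => ?_
  have hsub := Set.sdiff_subset_sdiff_left (t := D) (Set.subset_union_right (s := B)
    (t := {a | a ∈ p.support}))
  obtain hxB | hxp := hx.1
  · exact ⟨x, hxB, .refl hx⟩
  · obtain hxy | hxz := reachableIn_end_of_isPath hp hxp hD hx.2
    · exact ⟨y, hy, hxy.mono hsub⟩
    · exact ⟨z, hz, hxz.mono hsub⟩

/-- A walk avoiding `v` from `B` to a neighbour of `v` in `B'`, closed up at `v`, is an ear on `B`
that meets `B'` in an edge. -/
theorem IsNonseparable.exists_superset (hB : IsNonseparable G B) (hB' : IsNonseparable G B')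
    (hv : v ∈ B) (hv' : v ∈ B') (hz : z ∈ B) (hy : y ∈ B') (h : ReachableIn G {v}ᶜ z y) :
    ∃ U, IsNonseparable G U ∧ B ⊆ U ∧ B' ⊆ U := by
  classical
  obtain ⟨a, ha, hva⟩ := hB'.exists_adj hv' hy (Ne.symm h.right_mem)
  obtain ⟨q, hq⟩ := h.trans (hB'.reachableIn_compl hy h.right_mem ha hva.ne')
  have hvq : v ∉ q.bypass.support := fun hv => hq v (q.support_bypass_subset_support hv) rfl
  have hear := hB.union_support_of_isPath (q.bypass_isPath.concat hvq hva.symm) hz hv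
  refine ⟨_, hear.union hB' ⟨v, ⟨.inl hv, hv'⟩, a, ⟨.inr ?_, ha⟩, hva.ne⟩,
    fun x hx => .inl (.inl hx), Set.subset_union_right⟩
  simp [SimpleGraph.Walk.support_concat]

end Nonseparable

section Block

variable {V : Type*} {G : SimpleGraph V} {S B B' : Set V} {x y z v : V}

theorem IsBlock.isNonseparable (h : IsBlock G B) : IsNonseparable G B :=
  h.prop

theorem IsBlock.nonempty (h : IsBlock G B) : B.Nonempty :=
  h.isNonseparable.nonempty

theorem IsBlock.eq_of_reachableIn_compl (hB : IsBlock G B) (hB' : IsBlock G B') (hv : v ∈ B)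
    (hv' : v ∈ B') (hz : z ∈ B) (hy : y ∈ B') (h : ReachableIn G {v}ᶜ z y) : B = B' := by
  obtain ⟨U, hU, hBU, hBU'⟩ := hB.isNonseparable.exists_superset hB'.isNonseparable hv hv' hz hy h
  exact (hB.eq_of_subset hU hBU).trans (hB'.eq_of_subset hU hBU').symm

theorem IsBlock.exists_ne (hB : IsBlock G B) (hB' : IsBlock G B') (hne : B ≠ B') (hv' : v ∈ B') :
    ∃ x ∈ B, x ≠ v := by
  by_contra! h
  exact hne (hB.eq_of_subset hB'.isNonseparable fun x hx => (h x hx) ▸ hv')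

variable [Finite V]

theorem IsNonseparable.exists_isBlock (h : IsNonseparable G S) : ∃ B, IsBlock G B ∧ S ⊆ B := by
  obtain ⟨B, hSB, hB⟩ := (Set.toFinite {S | IsNonseparable G S}).exists_le_maximal h
  exact ⟨B, hB, hSB⟩

theorem exists_isBlock_mem (G : SimpleGraph V) (v : V) : ∃ B, IsBlock G B ∧ v ∈ B := by
  obtain ⟨B, hB, h⟩ := (isNonseparable_of_isClique (Set.singleton_nonempty v)
    (SimpleGraph.isClique_singleton (G := G) v)).exists_isBlock
  exact ⟨B, hB, h rfl⟩

theorem exists_isBlock_of_adj (h : G.Adj x y) : ∃ B, IsBlock G B ∧ x ∈ B ∧ y ∈ B := by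
  obtain ⟨B, hB, hs⟩ := (isNonseparable_of_isClique (Set.insert_nonempty x {y})
    (SimpleGraph.isClique_pair.2 fun _ => h)).exists_isBlock
  exact ⟨B, hB, hs (.inl rfl), hs (.inr rfl)⟩

theorem isCutVertex_iff_exists_isBlock :
    IsCutVertex G v ↔ ∃ B B', IsBlock G B ∧ IsBlock G B' ∧ B ≠ B' ∧ v ∈ B ∧ v ∈ B' := by
  rw [isCutVertex_iff]
  constructor
  · rintro ⟨x, y, hx, hy, ⟨p⟩, hsep⟩
    have hvp : v ∈ p.support := by
      by_contra hvp
      exact hsep ⟨p, fun a ha e => hvp (e ▸ ha)⟩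
    obtain ⟨q, r, rfl⟩ := SimpleGraph.Walk.mem_support_iff_exists_append.1 hvp
    obtain ⟨a, hav, hxa⟩ := exists_adj_reachableIn_compl q hx
    obtain ⟨b, hbv, hyb⟩ := exists_adj_reachableIn_compl r.reverse hy
    obtain ⟨B, hB, haB, hvB⟩ := exists_isBlock_of_adj hav
    obtain ⟨B', hB', hbB', hvB'⟩ := exists_isBlock_of_adj hbv
    refine ⟨B, B', hB, hB', ?_, hvB, hvB'⟩
    rintro rfl
    exact hsep (hxa.trans
      ((hB.isNonseparable.reachableIn_compl haB hav.ne hbB' hbv.ne).trans hyb.symm))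
  · rintro ⟨B, B', hB, hB', hne, hv, hv'⟩
    obtain ⟨x, hx, hxv⟩ := hB.exists_ne hB' hne hv'
    obtain ⟨y, hy, hyv⟩ := hB'.exists_ne hB hne.symm hv
    exact ⟨x, y, hxv, hyv, (hB.isNonseparable.reachableIn hx hv).reachable.trans
      (hB'.isNonseparable.reachableIn hv' hy).reachable,
      fun h => hne (hB.eq_of_reachableIn_compl hB' hv hv' hx hy h)⟩

theorem IsBlock.eq_of_not_isCutVertex (hB : IsBlock G B) (hB' : IsBlock G B')
    (hv : ¬ IsCutVertex G v) (hvB : v ∈ B) (hvB' : v ∈ B') : B = B' := by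
  by_contra hne
  exact hv (isCutVertex_iff_exists_isBlock.2 ⟨B, B', hB, hB', hne, hvB, hvB'⟩)

end Block

section Incidence

variable {V : Type*} {G : SimpleGraph V} {v : V}

/-- The bipartite incidence graph of the vertices and the blocks of `G`; the block tree is its
restriction to the cut vertices and the blocks. -/
def blockIncidenceGraph (G : SimpleGraph V) : SimpleGraph (V ⊕ {S : Set V // IsBlock G S}) where
  Adj
    | Sum.inl v, Sum.inr B => v ∈ B.1
    | Sum.inr B, Sum.inl v => v ∈ B.1
    | _, _ => False
  symm := ⟨by rintro (a | a) (b | b) h <;> exact h⟩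
  loopless := ⟨by rintro (a | a) h <;> exact h⟩

/-- The vertices reachable from `B` without passing through `v`, the blocks that contain such a
vertex, and `B` itself, are left by no edge other than the bridge, and `v` is not among them. -/
theorem isBridge_blockIncidenceGraph {B : {S : Set V // IsBlock G S}} (hv : v ∈ B.1) :
    (blockIncidenceGraph G).IsBridge s(Sum.inr B, Sum.inl v) := by
  rw [SimpleGraph.isBridge_iff]
  rintro ⟨p⟩
  let R : Set V := {x | ∃ z ∈ B.1, ReachableIn G {v}ᶜ z x}
  have mem_of_mem_block : ∀ (C : {S : Set V // IsBlock G S}) (x : V), x ∈ C.1 → x ≠ v →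
      C = B ∨ (C.1 ∩ R).Nonempty → x ∈ R := by
    rintro C x hx hxv (rfl | ⟨y, hy, z, hz, hzy⟩)
    · exact ⟨x, hx, .refl hxv⟩
    · exact ⟨z, hz, hzy.trans (C.2.isNonseparable.reachableIn_compl hy hzy.right_mem hx hxv)⟩
  have eq_of_mem_block : ∀ C : {S : Set V // IsBlock G S}, v ∈ C.1 →
      C = B ∨ (C.1 ∩ R).Nonempty → C = B := by
    rintro C hvC (rfl | ⟨y, hy, z, hz, hzy⟩)
    · rfl
    · exact Subtype.ext (B.2.eq_of_reachableIn_compl C.2 hv hvC hz hy hzy).symm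
  have hvR : Sum.elim (· ∈ R) (fun C => C = B ∨ (C.1 ∩ R).Nonempty) (Sum.inl v) := by
    refine ReachableIn.induction_on (S := Set.univ) ⟨p, fun _ _ => trivial⟩ (.inl rfl) ?_
    rintro (x | C) - (x' | C') - ⟨hadj, hne⟩ ha
    · exact hadj.elim
    · exact .inr ⟨x, hadj, ha⟩
    · refine mem_of_mem_block C x' hadj ?_ ha
      rintro rfl
      obtain rfl := eq_of_mem_block C hadj ha
      exact hne (by simp)
    · exact hadj.elim
  obtain ⟨z, -, hzv⟩ := hvR
  exact hzv.right_mem rfl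

theorem isAcyclic_blockIncidenceGraph (G : SimpleGraph V) : (blockIncidenceGraph G).IsAcyclic := by
  rw [SimpleGraph.isAcyclic_iff_forall_adj_isBridge]
  rintro (v | B) (w | C) h
  · exact h.elim
  · rw [Sym2.eq_swap]
    exact isBridge_blockIncidenceGraph h
  · exact isBridge_blockIncidenceGraph h
  · exact h.elim

theorem not_reachableIn_compl_of_isAcyclic {T : SimpleGraph V} (hT : T.IsAcyclic) {s a b : V}
    (ha : T.Adj s a) (hb : T.Adj s b) (hab : a ≠ b) : ¬ ReachableIn T {s}ᶜ a b := by
  classical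
  rintro ⟨p, hp⟩
  have hs : s ∉ p.bypass.support := fun h => hp s (p.support_bypass_subset_support h) rfl
  have heq := (hT.subsingleton_path a b).elim ⟨p.bypass, p.bypass_isPath⟩
    ⟨.cons ha.symm (.cons hb .nil), by simp [SimpleGraph.Walk.isPath_def, ha.ne', hb.ne, hab]⟩
  refine hs ?_
  rw [show p.bypass = _ from congrArg Subtype.val heq]
  simp

end Incidence

section Layout

variable {U X : Type*} {T : SimpleGraph U} {C : Set U} {t : X → U} {S : Set X} {c d : U}
  {s x y : X}

/-- If the vertices of a graph are placed on the vertices of `T` by `t`, this is the set of those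
placed in the closed neighbourhood of `c`. -/
def bag (T : SimpleGraph U) (t : X → U) (c : U) : Set X :=
  {x | t x = c ∨ T.Adj c (t x)}

/-- The union of the cliques on the bags of the vertices in `C`. Block graphs arise in this way
from a tree, with its block vertices as `C`, and from the incidence graph of the vertices and the
blocks of a graph, with the vertices as `C`. -/
def bagGraph (T : SimpleGraph U) (C : Set U) (t : X → U) : SimpleGraph X where
  Adj x y := x ≠ y ∧ ∃ c ∈ C, x ∈ bag T t c ∧ y ∈ bag T t c
  symm := ⟨fun _ _ ⟨hne, c, hc, hx, hy⟩ => ⟨hne.symm, c, hc, hy, hx⟩⟩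
  loopless := ⟨fun _ h => h.1 rfl⟩

/-- `T` is acyclic, no two vertices in `C` are adjacent, and any other vertex of `T` carries at
most one vertex. Then two bags of vertices in `C` share at most one vertex, which separates
them. -/
structure IsForestLayout (T : SimpleGraph U) (C : Set U) (t : X → U) : Prop where
  isAcyclic : T.IsAcyclic
  isIndepSet : T.IsIndepSet C
  eq_of_label_eq : ∀ x y, t x ∉ C → t x = t y → x = y

theorem isClique_bag (hc : c ∈ C) : (bagGraph T C t).IsClique (bag T t c) :=
  fun _ hx _ hy hne => ⟨hne, c, hc, hx, hy⟩

theorem adj_of_mem_bag (hc : c ∈ C) (hx : t x ∉ C) (hxc : x ∈ bag T t c) : T.Adj c (t x) :=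
  hxc.resolve_left fun e => hx (e ▸ hc)

namespace IsForestLayout

variable (h : IsForestLayout T C t)
include h

theorem not_adj (hc : c ∈ C) (hd : d ∈ C) : ¬ T.Adj c d :=
  fun hadj => h.isIndepSet hc hd hadj.ne hadj

theorem label_eq_of_mem_bag (hc : c ∈ C) (hx : t x ∈ C) (hxc : x ∈ bag T t c) : t x = c :=
  hxc.resolve_right (h.not_adj hc hx)

theorem eq_of_reachableIn_compl (hc : c ∈ C) (hd : d ∈ C) (hsc : s ∈ bag T t c)
    (hsd : s ∈ bag T t d) (hxc : x ∈ bag T t c) (hyd : y ∈ bag T t d)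
    (hxy : ReachableIn (bagGraph T C t) {s}ᶜ x y) : c = d := by
  by_contra hne
  have hs : t s ∉ C := fun hs => hne
    ((h.label_eq_of_mem_bag hc hs hsc).symm.trans (h.label_eq_of_mem_bag hd hs hsd))
  have label_mem : ∀ a ≠ s, t a ∈ ({t s} : Set U)ᶜ := fun a ha e =>
    ha (h.eq_of_label_eq s a hs (Eq.symm e)).symm
  have toCentre : ∀ a ≠ s, ∀ u ∈ C, a ∈ bag T t u → ReachableIn T {t s}ᶜ (t a) u := by
    intro a ha u hu hau
    have hus : u ∈ ({t s} : Set U)ᶜ := fun e => hs (Set.mem_singleton_iff.1 e ▸ hu)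
    obtain rfl | hadj := hau
    · exact .refl hus
    · exact .of_adj hadj.symm (label_mem a ha) hus
  refine not_reachableIn_compl_of_isAcyclic h.isAcyclic (adj_of_mem_bag hc hs hsc).symm
    (adj_of_mem_bag hd hs hsd).symm hne ?_
  refine (toCentre x hxy.left_mem c hc hxc).symm.trans (.trans ?_
    (toCentre y hxy.right_mem d hd hyd))
  refine hxy.map (label_mem x hxy.left_mem) fun a ha b hb hab _ => ?_
  obtain ⟨-, u, hu, hau, hbu⟩ := hab
  exact (toCentre a ha u hu hau).trans (toCentre b hb u hu hbu).symm

/-- A walk inside `S` cannot leave the bag of an edge of `S` at a vertex `a`: the rest of `S`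
connects the next vertex back to the bag without using `a`. -/
theorem exists_subset_bag (hS : IsNonseparable (bagGraph T C t) S) (hnt : S.Nontrivial) :
    ∃ c ∈ C, S ⊆ bag T t c := by
  obtain ⟨x, hx, x', hx', hne⟩ := hnt
  obtain ⟨b, hb, hxb⟩ := hS.exists_adj hx hx' hne
  obtain ⟨-, c, hc, hxc, hbc⟩ := id hxb
  refine ⟨c, hc, fun z hz => (hS.reachableIn hx hz).induction_on (P := (· ∈ bag T t c)) hxc ?_⟩
  rintro a - e he hae hac
  obtain ⟨-, d, hd, had, hed⟩ := id hae
  obtain ⟨r, hrS, hrc, hra⟩ : ∃ r ∈ S, r ∈ bag T t c ∧ r ≠ a := by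
    by_cases hax : a = x
    · exact ⟨b, hb, hbc, hax ▸ hxb.ne'⟩
    · exact ⟨x, hx, hxc, Ne.symm hax⟩
  obtain rfl := h.eq_of_reachableIn_compl hc hd hac had hrc hed
    (hS.reachableIn_compl hrS hra he hae.ne')
  exact hed

theorem isClique_of_isNonseparable (hS : IsNonseparable (bagGraph T C t) S) :
    (bagGraph T C t).IsClique S := by
  obtain hs | hnt := S.subsingleton_or_nontrivial
  · exact .of_subsingleton hs
  · obtain ⟨c, hc, hSc⟩ := h.exists_subset_bag hS hnt
    exact (isClique_bag hc).subset hSc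

end IsForestLayout

/-- A forest layout with enough vertices for the bags to be the blocks of `bagGraph T C t`. -/
structure IsTightLayout (T : SimpleGraph U) (C : Set U) (t : X → U) : Prop
    extends IsForestLayout T C t where
  exists_label_eq : ∀ u ∉ C, ∃ x, t x = u
  exists_adj : ∀ u ∉ C, ∃ c ∈ C, T.Adj c u
  exists_label_eq_of_isLeaf : ∀ c ∈ C, IsLeaf T c → ∃ x, t x = c

namespace IsTightLayout

variable (h : IsTightLayout T C t)
include h

theorem exists_mem_bag (x : X) : ∃ c ∈ C, x ∈ bag T t c := by
  by_cases hx : t x ∈ C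
  · exact ⟨t x, hx, .inl rfl⟩
  · obtain ⟨c, hc, hadj⟩ := h.exists_adj (t x) hx
    exact ⟨c, hc, .inr hadj⟩

theorem exists_label_eq_of_adj (hc : c ∈ C) {u : U} (hadj : T.Adj c u) :
    ∃ x, t x = u ∧ x ∈ bag T t c := by
  obtain ⟨x, rfl⟩ := h.exists_label_eq u fun hu => h.not_adj hc hu hadj
  exact ⟨x, rfl, .inr hadj⟩

theorem nonempty_bag (hc : c ∈ C) : (bag T t c).Nonempty := by
  by_cases hleaf : IsLeaf T c
  · obtain ⟨x, hx⟩ := h.exists_label_eq_of_isLeaf c hc hleaf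
    exact ⟨x, .inl hx⟩
  · obtain ⟨u, hu, -⟩ := Set.not_subsingleton_iff.1 hleaf
    obtain ⟨x, -, hx⟩ := h.exists_label_eq_of_adj hc hu
    exact ⟨x, hx⟩

theorem eq_of_bag_subset (hc : c ∈ C) (hd : d ∈ C) (hcd : bag T t c ⊆ bag T t d) : c = d := by
  by_cases hleaf : IsLeaf T c
  · obtain ⟨x, rfl⟩ := h.exists_label_eq_of_isLeaf c hc hleaf
    exact h.label_eq_of_mem_bag hd hc (hcd (.inl rfl))
  · obtain ⟨a, ha, b, hb, hab⟩ := Set.not_subsingleton_iff.1 hleaf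
    obtain ⟨x, rfl, hx⟩ := h.exists_label_eq_of_adj hc ha
    obtain ⟨y, rfl, hy⟩ := h.exists_label_eq_of_adj hc hb
    exact h.eq_of_reachableIn_compl hc hd hx (hcd hx) hy (hcd hy)
      (.refl fun e => hab (congrArg t e).symm)

theorem isBlock_iff : IsBlock (bagGraph T C t) S ↔ ∃ c ∈ C, S = bag T t c := by
  have subset_bag : ∀ S, IsNonseparable (bagGraph T C t) S → ∃ c ∈ C, S ⊆ bag T t c := by
    intro S hS
    obtain hs | hnt := S.subsingleton_or_nontrivial
    · obtain ⟨x, hx⟩ := hS.nonempty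
      obtain ⟨c, hc, hxc⟩ := h.exists_mem_bag x
      exact ⟨c, hc, fun y hy => hs hx hy ▸ hxc⟩
    · exact h.exists_subset_bag hS hnt
  have isNonseparable_bag : ∀ c ∈ C, IsNonseparable (bagGraph T C t) (bag T t c) := fun c hc =>
    isNonseparable_of_isClique (h.nonempty_bag hc) (isClique_bag hc)
  constructor
  · intro hS
    obtain ⟨c, hc, hSc⟩ := subset_bag S hS.isNonseparable
    exact ⟨c, hc, hS.eq_of_subset (isNonseparable_bag c hc) hSc⟩
  · rintro ⟨c, hc, rfl⟩
    refine ⟨isNonseparable_bag c hc, fun S hS hcS => ?_⟩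
    obtain ⟨d, hd, hSd⟩ := subset_bag S hS
    obtain rfl := h.eq_of_bag_subset hc hd (hcS.trans hSd)
    exact hSd

end IsTightLayout

/-- The correspondence between the vertices in `C` and the blocks, sending a vertex to its bag. -/
noncomputable def IsTightLayout.blockEquiv (h : IsTightLayout T C t) :
    C ≃ {S : Set X // IsBlock (bagGraph T C t) S} :=
  Equiv.ofBijective (fun c => ⟨bag T t c, h.isBlock_iff.2 ⟨c, c.2, rfl⟩⟩)
    ⟨fun c d hcd => Subtype.ext (h.eq_of_bag_subset c.2 d.2 (congrArg Subtype.val hcd).subset),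
      fun ⟨_, hS⟩ =>
        let ⟨c, hc, hSc⟩ := h.isBlock_iff.1 hS
        ⟨⟨c, hc⟩, Subtype.ext hSc.symm⟩⟩

end Layout

section BlockGraph

variable {V X : Type*} {G : SimpleGraph V}

theorem isForestLayout_blockIncidenceGraph {t : X → V ⊕ {S : Set V // IsBlock G S}}
    (ht : Function.Injective t) :
    IsForestLayout (blockIncidenceGraph G) (Set.range Sum.inl) t where
  isAcyclic := isAcyclic_blockIncidenceGraph G
  isIndepSet := by
    rintro _ ⟨v, rfl⟩ _ ⟨w, rfl⟩ - h
    exact h.elim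
  eq_of_label_eq _ _ _ hxy := ht hxy

theorem isTightLayout_blockIncidenceGraph (e : X ≃ V ⊕ {S : Set V // IsBlock G S}) :
    IsTightLayout (blockIncidenceGraph G) (Set.range Sum.inl) e where
  toIsForestLayout := isForestLayout_blockIncidenceGraph e.injective
  exists_label_eq u _ := e.surjective u
  exists_adj := by
    rintro (v | B) hu
    · exact absurd ⟨v, rfl⟩ hu
    · obtain ⟨v, hv⟩ := B.2.nonempty
      exact ⟨Sum.inl v, ⟨v, rfl⟩, hv⟩
  exists_label_eq_of_isLeaf c _ _ := e.surjective c

theorem IsBlockGraph.isClique_of_isNonseparable (h : IsBlockGraph G) {S : Set V}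
    (hS : IsNonseparable G S) : G.IsClique S := by
  obtain ⟨k, H, ⟨f⟩⟩ := h
  have hG : G = bagGraph (blockIncidenceGraph H) (Set.range Sum.inl) (Sum.inr ∘ f) := by
    ext x y
    rw [← f.map_adj_iff]
    change _ ∧ _ ↔ _ ∧ _
    simp [f.injective.ne_iff, bag, blockIncidenceGraph, Set.Nonempty]
  rw [hG] at hS ⊢
  exact (isForestLayout_blockIncidenceGraph
    (Sum.inr_injective.comp f.injective)).isClique_of_isNonseparable hS

theorem inter_bag_blockIncidenceGraph_nonempty_iff (e : X ≃ V ⊕ {S : Set V // IsBlock G S})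
    {v w : V} (hne : v ≠ w) :
    (bag (blockIncidenceGraph G) e (Sum.inl v) ∩
      bag (blockIncidenceGraph G) e (Sum.inl w)).Nonempty ↔ ∃ B, IsBlock G B ∧ v ∈ B ∧ w ∈ B := by
  constructor
  · rintro ⟨x, hxv, hxw⟩
    obtain hx | hx := hxv <;> obtain hx' | hx' := hxw
    · exact absurd (Sum.inl_injective (hx.symm.trans hx')) hne
    · exact (hx ▸ hx').elim
    · exact (hx' ▸ hx).elim
    · cases hB : e x with
      | inl u => exact (hB ▸ hx).elim
      | inr B =>
        rw [hB] at hx hx'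
        exact ⟨B.1, B.2, hx, hx'⟩
  · rintro ⟨B, hB, hv, hw⟩
    obtain ⟨x, hx⟩ := e.surjective (Sum.inr ⟨B, hB⟩)
    refine ⟨x, .inr ?_, .inr ?_⟩ <;> rw [hx]
    exacts [hv, hw]

/-- Such a graph is `B(H)` for the graph `H` on its vertices and blocks in which each vertex forms
a clique with the blocks that contain it. -/
theorem isBlockGraph_of_isClique [Finite V] (h : ∀ B, IsBlock G B → G.IsClique B) :
    IsBlockGraph G := by
  let e := (Finite.equivFin (V ⊕ {S : Set V // IsBlock G S})).symm
  let F := (Equiv.ofInjective _ Sum.inl_injective).trans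
    (isTightLayout_blockIncidenceGraph e).blockEquiv
  refine ⟨_, _, ⟨⟨F, fun {v w} => ?_⟩⟩⟩
  change F v ≠ F w ∧ (bag _ e (Sum.inl v) ∩ bag _ e (Sum.inl w)).Nonempty ↔ _
  rw [F.injective.ne_iff]
  constructor
  · rintro ⟨hne, hmeet⟩
    obtain ⟨B, hB, hv, hw⟩ := (inter_bag_blockIncidenceGraph_nonempty_iff e hne).1 hmeet
    exact h B hB hv hw hne
  · intro hadj
    exact ⟨hadj.ne, (inter_bag_blockIncidenceGraph_nonempty_iff e hadj.ne).2
      (exists_isBlock_of_adj hadj)⟩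

end BlockGraph

section Tree

variable {U : Type*} {T : SimpleGraph U} {w : U → ℕ} {u v l : U}

theorem IsLeaf.isBlockVertex (h : IsLeaf T l) : IsBlockVertex T l :=
  ⟨l, h, by simp⟩

theorem exists_isLeaf [Finite U] (hT : T.IsTree) : ∃ l, IsLeaf T l := by
  classical
  have := Fintype.ofFinite U
  obtain ⟨u⟩ := hT.connected.nonempty
  obtain hsub | hnt := subsingleton_or_nontrivial U
  · exact ⟨u, Set.subsingleton_of_subsingleton⟩
  · obtain ⟨l, hl⟩ := hT.exists_vert_degree_one_of_nontrivial
    exact ⟨l, fun _ hu _ hv =>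
      (SimpleGraph.degree_eq_one_iff_existsUnique_adj.1 hl).unique hu hv⟩

theorem even_dist_iff_of_coloring (hT : T.Connected) (c : T.Coloring Bool) (u v : U) :
    Even (T.dist u v) ↔ (c u ↔ c v) := by
  obtain ⟨p, hp⟩ := hT.exists_walk_length_eq_dist u v
  rw [← hp, c.even_length_iff_congr p]

theorem isBlockVertex_iff_of_coloring [Finite U] (hT : T.IsTree) (c : T.Coloring Bool)
    (hleaf : ∀ l, IsLeaf T l → c l) (u : U) : IsBlockVertex T u ↔ c u := by
  constructor
  · rintro ⟨l, hl, heven⟩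
    exact ((even_dist_iff_of_coloring hT.connected c u l).1 heven).2 (hleaf l hl)
  · intro hu
    obtain ⟨l, hl⟩ := exists_isLeaf hT
    exact ⟨l, hl, (even_dist_iff_of_coloring hT.connected c u l).2
      (iff_of_true hu (hleaf l hl))⟩

/-- The intrinsic conditions that characterise weighted block trees. -/
structure IsAdmissible (T : SimpleGraph U) (w : U → ℕ) : Prop where
  isTree : T.IsTree
  even_dist : ∀ l l', IsLeaf T l → IsLeaf T l' → Even (T.dist l l')
  weight_eq_one : ∀ v, ¬ IsBlockVertex T v → w v = 1
  one_le_weight : ∀ l, IsLeaf T l → 1 ≤ w l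

theorem isAdmissible_iff :
    IsAdmissible T w ↔ T.IsTree ∧
      (∀ l l' : U, IsLeaf T l → IsLeaf T l' → Even (T.dist l l')) ∧
      (∀ v : U, ¬ IsBlockVertex T v → w v = 1) ∧ (∀ l : U, IsLeaf T l → 1 ≤ w l) :=
  ⟨fun h => ⟨h.isTree, h.even_dist, h.weight_eq_one, h.one_le_weight⟩,
    fun ⟨hT, heven, hone, hle⟩ => ⟨hT, heven, hone, hle⟩⟩

theorem IsAdmissible.isBlockVertex_iff_of_adj [Finite U] (h : IsAdmissible T w) (huv : T.Adj u v) :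
    IsBlockVertex T u ↔ ¬ IsBlockVertex T v := by
  obtain ⟨l, hl⟩ := exists_isLeaf h.isTree
  let c : T.Coloring Bool := .mk (fun v => decide (Even (T.dist l v))) fun {u v} huv heq => by
    obtain hd | hd := h.isTree.dist_eq_dist_add_one_of_adj l huv <;>
      simp only [hd, Nat.even_add_one, decide_eq_decide] at heq
    · exact iff_not_self heq.symm
    · exact iff_not_self heq
  have hc := isBlockVertex_iff_of_coloring h.isTree c fun l' hl' =>
    decide_eq_true (h.even_dist l l' hl hl')
  rw [hc, hc, Bool.not_eq_true, ← Bool.not_eq_true', Bool.eq_not.2 (c.valid huv)]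

end Tree

section Iso

variable {U U' : Type*} {T : SimpleGraph U} {T' : SimpleGraph U'} {w : U → ℕ} {w' : U' → ℕ}

theorem dist_hom_le (f : T →g T') {u v : U} (h : T.Reachable u v) :
    T'.dist (f u) (f v) ≤ T.dist u v := by
  obtain ⟨p, hp⟩ := h.exists_walk_length_eq_dist
  rw [← hp, ← SimpleGraph.Walk.length_map f p]
  exact SimpleGraph.dist_le _

theorem dist_iso (f : T ≃g T') (u v : U) : T'.dist (f u) (f v) = T.dist u v := by
  by_cases h : T.Reachable u v
  · refine le_antisymm (dist_hom_le f.toHom h) ?_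
    simpa using dist_hom_le f.symm.toHom (f.reachable_iff.2 h)
  · rw [SimpleGraph.dist_eq_zero_of_not_reachable h,
      SimpleGraph.dist_eq_zero_of_not_reachable (mt f.reachable_iff.1 h)]

theorem isLeaf_iso_iff (f : T ≃g T') {u : U} : IsLeaf T' (f u) ↔ IsLeaf T u := by
  simp only [IsLeaf, Set.Subsingleton, SimpleGraph.mem_neighborSet, f.surjective.forall,
    f.map_adj_iff, f.injective.eq_iff]

theorem isBlockVertex_iso_iff (f : T ≃g T') {u : U} :
    IsBlockVertex T' (f u) ↔ IsBlockVertex T u := by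
  simp only [IsBlockVertex, f.surjective.exists, isLeaf_iso_iff, dist_iso]

theorem IsAdmissible.of_weightedIso (h : IsAdmissible T w) (hiso : WeightedIso T w T' w') :
    IsAdmissible T' w' := by
  obtain ⟨f, hf⟩ := hiso
  refine ⟨f.isTree_iff.1 h.isTree, ?_, ?_, ?_⟩
  · simpa only [f.surjective.forall, isLeaf_iso_iff, dist_iso] using h.even_dist
  · simpa only [f.surjective.forall, isBlockVertex_iso_iff, hf] using h.weight_eq_one
  · simpa only [f.surjective.forall, isLeaf_iso_iff, hf] using h.one_le_weight

end Iso

section BlockTree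

variable {V : Type*} {G : SimpleGraph V}

theorem isAcyclic_blockTree (G : SimpleGraph V) : (blockTree G).IsAcyclic := by
  refine (isAcyclic_blockIncidenceGraph G).comap
    ⟨Sum.map Subtype.val id, ?_⟩ (Subtype.val_injective.sumMap Function.injective_id)
  rintro (a | a) (b | b) h
  exacts [h.elim, h, h, h.elim]

variable [Finite V]

theorem reachable_blockTree_of_mem {B C : {S : Set V // IsBlock G S}} {x : V} (hB : x ∈ B.1)
    (hC : x ∈ C.1) : (blockTree G).Reachable (Sum.inr B) (Sum.inr C) := by
  obtain rfl | hBC := eq_or_ne B C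
  · exact .rfl
  · have hx : IsCutVertex G x := isCutVertex_iff_exists_isBlock.2
      ⟨B.1, C.1, B.2, C.2, Subtype.coe_ne_coe.2 hBC, hB, hC⟩
    have hBx : (blockTree G).Adj (Sum.inr B) (Sum.inl ⟨x, hx⟩) := hB
    have hxC : (blockTree G).Adj (Sum.inl ⟨x, hx⟩) (Sum.inr C) := hC
    exact hBx.reachable.trans hxC.reachable

theorem reachable_blockTree_of_reachable {B C : {S : Set V // IsBlock G S}} {x y : V}
    (h : G.Reachable x y) (hB : x ∈ B.1) (hC : y ∈ C.1) :
    (blockTree G).Reachable (Sum.inr B) (Sum.inr C) := by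
  obtain ⟨p⟩ := h
  induction p generalizing B with
  | nil => exact reachable_blockTree_of_mem hB hC
  | cons hadj _ ih =>
    obtain ⟨D, hD, hxD, hyD⟩ := exists_isBlock_of_adj hadj
    exact (reachable_blockTree_of_mem (C := ⟨D, hD⟩) hB hxD).trans (ih hyD hC)

theorem isTree_blockTree (hG : G.Connected) : (blockTree G).IsTree := by
  have exists_block : ∀ a, ∃ B, (blockTree G).Reachable a (Sum.inr B) := by
    rintro (v | B)
    · obtain ⟨B, hB, hv⟩ := exists_isBlock_mem G v.1
      have hadj : (blockTree G).Adj (Sum.inl v) (Sum.inr ⟨B, hB⟩) := hv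
      exact ⟨_, hadj.reachable⟩
    · exact ⟨B, .rfl⟩
  obtain ⟨x⟩ := hG.nonempty
  obtain ⟨D, hD, -⟩ := exists_isBlock_mem G x
  have : Nonempty (BlockTreeVertex G) := ⟨Sum.inr ⟨D, hD⟩⟩
  refine ⟨⟨fun a b => ?_⟩, isAcyclic_blockTree G⟩
  obtain ⟨B, hB⟩ := exists_block a
  obtain ⟨C, hC⟩ := exists_block b
  obtain ⟨y, hy⟩ := B.2.nonempty
  obtain ⟨z, hz⟩ := C.2.nonempty
  exact hB.trans ((reachable_blockTree_of_reachable (hG y z) hy hz).trans hC.symm)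

theorem isRight_of_isLeaf_blockTree {a : BlockTreeVertex G} (ha : IsLeaf (blockTree G) a) :
    a.isRight := by
  obtain ⟨v, hv⟩ | B := a
  · obtain ⟨B, C, hB, hC, hne, hvB, hvC⟩ := isCutVertex_iff_exists_isBlock.1 hv
    have heq := @ha (Sum.inr ⟨B, hB⟩) hvB (Sum.inr ⟨C, hC⟩) hvC
    exact absurd (congrArg Subtype.val (Sum.inr_injective heq)) hne
  · rfl

/-- Colouring the cut vertices and the blocks differently. -/
def blockTreeColoring (G : SimpleGraph V) : (blockTree G).Coloring Bool :=
  .mk Sum.isRight (by rintro (a | a) (b | b) h <;> first | exact h.elim | simp)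

theorem isBlockVertex_blockTree_iff (hG : G.Connected) (a : BlockTreeVertex G) :
    IsBlockVertex (blockTree G) a ↔ a.isRight :=
  isBlockVertex_iff_of_coloring (isTree_blockTree hG) (blockTreeColoring G)
    (fun _ => isRight_of_isLeaf_blockTree) a

theorem exists_not_isCutVertex_of_isLeaf_blockTree {B : {S : Set V // IsBlock G S}}
    (hB : IsLeaf (blockTree G) (Sum.inr B)) : ∃ x ∈ B.1, ¬ IsCutVertex G x := by
  obtain ⟨x, hx⟩ := B.2.nonempty
  by_cases hcut : IsCutVertex G x
  · obtain ⟨C, hC, hne, hxC⟩ : ∃ C, IsBlock G C ∧ B.1 ≠ C ∧ x ∈ C := by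
      obtain ⟨C, D, hC, hD, hne, hxC, hxD⟩ := isCutVertex_iff_exists_isBlock.1 hcut
      by_cases h : B.1 = C
      · exact ⟨D, hD, h ▸ hne, hxD⟩
      · exact ⟨C, hC, h, hxC⟩
    obtain ⟨y, hy, hyx⟩ := B.2.exists_ne hC hne hxC
    refine ⟨y, hy, fun hycut => hyx ?_⟩
    have heq := @hB (Sum.inl ⟨y, hycut⟩) hy (Sum.inl ⟨x, hcut⟩) hx
    exact congrArg Subtype.val (Sum.inl_injective heq)
  · exact ⟨x, hx, hcut⟩

theorem isAdmissible_blockTree (hG : G.Connected) :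
    IsAdmissible (blockTree G) (blockTreeWeight G) where
  isTree := isTree_blockTree hG
  even_dist l l' hl hl' :=
    (even_dist_iff_of_coloring (isTree_blockTree hG).connected (blockTreeColoring G) l l').2
      (iff_of_true (isRight_of_isLeaf_blockTree hl) (isRight_of_isLeaf_blockTree hl'))
  weight_eq_one a ha := by
    rw [isBlockVertex_blockTree_iff hG] at ha
    obtain v | B := a
    · rfl
    · exact absurd rfl ha
  one_le_weight a ha := by
    obtain v | B := a
    · exact absurd (isRight_of_isLeaf_blockTree ha) (by simp)
    · obtain ⟨x, hx, hcut⟩ := exists_not_isCutVertex_of_isLeaf_blockTree ha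
      exact (Set.ncard_pos (Set.toFinite _)).2 ⟨x, hx, hcut⟩

end BlockTree

section Layout

variable {U X : Type*} {T : SimpleGraph U} {C : Set U} {t : X → U} {u v : U} {x y : X}

namespace IsTightLayout

variable (h : IsTightLayout T C t)
include h

theorem exists_mem_bag_of_adj (huv : T.Adj u v) : ∃ x, x ∈ bag T t u ∧ x ∈ bag T t v := by
  by_cases hu : u ∈ C
  · obtain ⟨x, rfl⟩ := h.exists_label_eq v fun hv => h.not_adj hu hv huv
    exact ⟨x, .inr huv, .inl rfl⟩
  · obtain ⟨x, rfl⟩ := h.exists_label_eq u hu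
    exact ⟨x, .inl rfl, .inr huv.symm⟩

theorem reachable_of_mem_bag (hC : T.IsIndepSet Cᶜ) (hx : x ∈ bag T t u) (hy : y ∈ bag T t u) :
    (bagGraph T C t).Reachable x y := by
  have reachable_of_mem : ∀ c ∈ C, ∀ x y, x ∈ bag T t c → y ∈ bag T t c →
      (bagGraph T C t).Reachable x y := by
    intro c hc x y hx hy
    obtain rfl | hne := eq_or_ne x y
    · exact .rfl
    · exact (isClique_bag hc hx hy hne).reachable
  by_cases hu : u ∈ C
  · exact reachable_of_mem u hu x y hx hy
  · obtain ⟨s, rfl⟩ := h.exists_label_eq u hu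
    have reachable_centre : ∀ z ∈ bag T t (t s), (bagGraph T C t).Reachable z s := by
      rintro z (hz | hz)
      · rw [h.eq_of_label_eq s z hu hz.symm]
      · have hzC : t z ∈ C := by_contra fun hzC => hC hu hzC hz.ne hz
        exact reachable_of_mem (t z) hzC z s (.inl rfl) (.inr hz.symm)
    exact (reachable_centre x hx).trans (reachable_centre y hy).symm

theorem connected (hT : T.Connected) (hC : T.IsIndepSet Cᶜ) : (bagGraph T C t).Connected := by
  have reachable_of_walk : ∀ {u v : U} (_ : T.Walk u v) (x y : X), x ∈ bag T t u →
      y ∈ bag T t v → (bagGraph T C t).Reachable x y := by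
    intro u v p
    induction p with
    | nil => exact fun _ _ => h.reachable_of_mem_bag hC
    | cons hadj _ ih =>
      intro x y hx hy
      obtain ⟨z, hz, hz'⟩ := h.exists_mem_bag_of_adj hadj
      exact (h.reachable_of_mem_bag hC hx hz).trans (ih z y hz' hy)
  have : Nonempty X := by
    obtain ⟨u⟩ := hT.nonempty
    by_cases hu : u ∈ C
    · exact (h.nonempty_bag hu).to_type
    · exact (h.exists_label_eq u hu).nonempty
  refine ⟨fun x y => ?_⟩
  obtain ⟨p⟩ := hT (t x) (t y)
  exact reachable_of_walk p x y (.inl rfl) (.inl rfl)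

theorem isCutVertex_iff [Finite X] (hleaf : ∀ u, IsLeaf T u → u ∈ C) (hC : T.IsIndepSet Cᶜ) :
    IsCutVertex (bagGraph T C t) x ↔ t x ∉ C := by
  rw [isCutVertex_iff_exists_isBlock]
  constructor
  · rintro ⟨B, B', hB, hB', hne, hx, hx'⟩ hxC
    obtain ⟨c, hc, rfl⟩ := h.isBlock_iff.1 hB
    obtain ⟨d, hd, rfl⟩ := h.isBlock_iff.1 hB'
    obtain rfl := (h.label_eq_of_mem_bag hc hxC hx).symm.trans (h.label_eq_of_mem_bag hd hxC hx')
    exact hne rfl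
  · intro hx
    obtain ⟨c, hcx, d, hdx, hne⟩ := Set.not_subsingleton_iff.1 (mt (hleaf (t x)) hx)
    have hc : c ∈ C := by_contra fun hc => hC hx hc hcx.ne hcx
    have hd : d ∈ C := by_contra fun hd => hC hx hd hdx.ne hdx
    exact ⟨bag T t c, bag T t d, h.isBlock_iff.2 ⟨c, hc, rfl⟩, h.isBlock_iff.2 ⟨d, hd, rfl⟩,
      fun e => hne (h.eq_of_bag_subset hc hd e.subset), .inr hcx.symm, .inr hdx.symm⟩

end IsTightLayout

/-- The correspondence between the cut vertices and the vertices outside `C`, sending a cut vertex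
to its label. -/
noncomputable def IsTightLayout.cutVertexEquiv [Finite X] (h : IsTightLayout T C t)
    (hleaf : ∀ u, IsLeaf T u → u ∈ C) (hC : T.IsIndepSet Cᶜ) :
    {x // IsCutVertex (bagGraph T C t) x} ≃ (Cᶜ : Set U) :=
  Equiv.ofBijective (fun x => ⟨t x, (h.isCutVertex_iff hleaf hC).1 x.2⟩)
    ⟨fun x y hxy => Subtype.ext (h.eq_of_label_eq x y ((h.isCutVertex_iff hleaf hC).1 x.2)
        (congrArg Subtype.val hxy)),
      fun ⟨u, hu⟩ =>
        let ⟨x, hx⟩ := h.exists_label_eq u hu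
        ⟨⟨x, (h.isCutVertex_iff hleaf hC).2 (hx ▸ hu)⟩, Subtype.ext hx⟩⟩

open Classical in
/-- The correspondence between the vertices of the block tree and those of `T`, sending a cut
vertex to its label and the bag of `c` to `c`. -/
noncomputable def IsTightLayout.blockTreeEquiv [Finite X] (h : IsTightLayout T C t)
    (hleaf : ∀ u, IsLeaf T u → u ∈ C) (hC : T.IsIndepSet Cᶜ) :
    BlockTreeVertex (bagGraph T C t) ≃ U :=
  ((h.cutVertexEquiv hleaf hC).sumCongr h.blockEquiv.symm).trans
    ((Equiv.sumComm _ _).trans (Equiv.Set.sumCompl C))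

section BlockTreeEquiv

variable [Finite X] (h : IsTightLayout T C t) (hleaf : ∀ u, IsLeaf T u → u ∈ C)
  (hC : T.IsIndepSet Cᶜ)

@[simp]
theorem IsTightLayout.blockTreeEquiv_inl (x : {x // IsCutVertex (bagGraph T C t) x}) :
    h.blockTreeEquiv hleaf hC (Sum.inl x) = t x :=
  rfl

@[simp]
theorem IsTightLayout.blockTreeEquiv_inr (c : C) :
    h.blockTreeEquiv hleaf hC (Sum.inr (h.blockEquiv c)) = c := by
  simp [blockTreeEquiv]

theorem IsTightLayout.adj_blockTreeEquiv_iff (a b : BlockTreeVertex (bagGraph T C t)) :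
    T.Adj (h.blockTreeEquiv hleaf hC a) (h.blockTreeEquiv hleaf hC b) ↔
      (blockTree (bagGraph T C t)).Adj a b := by
  have label_notMem : ∀ x : {x // IsCutVertex (bagGraph T C t) x}, t x ∉ C := fun x =>
    (h.isCutVertex_iff hleaf hC).1 x.2
  have adj_iff_mem : ∀ (c : C) (x : {x // IsCutVertex (bagGraph T C t) x}),
      T.Adj c (t x) ↔ x.1 ∈ bag T t c := fun c x =>
    ⟨.inr, adj_of_mem_bag c.2 (label_notMem x)⟩
  obtain x | B := a <;> obtain y | D := b
  · simp only [blockTreeEquiv_inl]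
    exact iff_of_false (fun hxy => hC (label_notMem x) (label_notMem y) hxy.ne hxy) id
  · obtain ⟨d, rfl⟩ := h.blockEquiv.surjective D
    rw [T.adj_comm, blockTreeEquiv_inl, blockTreeEquiv_inr, adj_iff_mem]
    rfl
  · obtain ⟨c, rfl⟩ := h.blockEquiv.surjective B
    rw [blockTreeEquiv_inl, blockTreeEquiv_inr, adj_iff_mem]
    rfl
  · obtain ⟨c, rfl⟩ := h.blockEquiv.surjective B
    obtain ⟨d, rfl⟩ := h.blockEquiv.surjective D
    simp only [blockTreeEquiv_inr]
    exact iff_of_false (h.not_adj c.2 d.2) id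

end BlockTreeEquiv

end Layout

section Represents

variable {U V W : Type*} {G : SimpleGraph V} {T : SimpleGraph U} {w : U → ℕ} {t : V → U}

/-- The labels `t` exhibit `G` as the graph described by `(T, w)`: each vertex `u` of `T` carries
`w u` vertices of `G`, and `G` is the union of the cliques on the bags of the block vertices. -/
structure Represents (G : SimpleGraph V) (T : SimpleGraph U) (w : U → ℕ) (t : V → U) : Prop where
  ncard_fiber : ∀ u, {x | t x = u}.ncard = w u
  eq_bagGraph : G = bagGraph T {u | IsBlockVertex T u} t

theorem Represents.nonempty_iso [Finite V] [Finite W] {G' : SimpleGraph W} {t' : W → U}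
    (h : Represents G T w t) (h' : Represents G' T w t') : Nonempty (G ≃g G') := by
  have hcard : ∀ u, Nonempty ({x // t x = u} ≃ {y // t' y = u}) := fun u =>
    Finite.card_eq.1 ((h.ncard_fiber u).trans (h'.ncard_fiber u).symm)
  let e := Equiv.ofFiberEquiv fun u => (hcard u).some
  have he : ∀ x, t' (e x) = t x := Equiv.ofFiberEquiv_map _
  obtain rfl := h.eq_bagGraph
  obtain rfl := h'.eq_bagGraph
  exact ⟨⟨e, fun {x y} => by simp only [bagGraph, bag, Set.mem_ofPred_eq, he, e.injective.ne_iff]⟩⟩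

theorem Represents.comp_iso {G' : SimpleGraph W} (h : Represents G T w t) (f : G' ≃g G) :
    Represents G' T w (t ∘ f) where
  ncard_fiber u := by
    rw [← h.ncard_fiber u]
    exact Nat.card_congr (f.toEquiv.subtypeEquiv fun _ => Iff.rfl)
  eq_bagGraph := by
    obtain rfl := h.eq_bagGraph
    ext x y
    rw [← f.map_adj_iff]
    exact and_congr_left fun _ => f.injective.ne_iff

theorem Represents.of_weightedIso {U' : Type*} {T' : SimpleGraph U'} {w' : U' → ℕ}
    (h : Represents G T w t) (hiso : WeightedIso T w T' w') :
    ∃ t' : V → U', Represents G T' w' t' := by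
  obtain ⟨f, hf⟩ := hiso
  refine ⟨f ∘ t, fun u => ?_, h.eq_bagGraph.trans ?_⟩
  · obtain ⟨u, rfl⟩ := f.surjective u
    rw [hf, ← h.ncard_fiber u]
    simp only [Function.comp_apply, f.injective.eq_iff]
  · ext x y
    simp only [bagGraph, bag, f.surjective.exists, isBlockVertex_iso_iff, Set.mem_ofPred_eq,
      Function.comp_apply, f.injective.eq_iff, f.map_adj_iff]

theorem Represents.card_eq [Fintype U] [Finite V] (h : Represents G T w t) :
    Nat.card V = ∑ u, w u := by
  rw [← Nat.card_congr (Equiv.sigmaFiberEquiv t), Nat.card_sigma]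
  exact Finset.sum_congr rfl fun u _ => h.ncard_fiber u

theorem Represents.exists_eq (h : Represents G T w t) {u : U} (hu : w u ≠ 0) : ∃ x, t x = u :=
  Set.nonempty_of_ncard_ne_zero (h.ncard_fiber u ▸ hu)

theorem exists_represents [Fintype U] (T : SimpleGraph U) (w : U → ℕ) :
    ∃ (G : SimpleGraph (Fin (∑ u, w u))) (t : Fin (∑ u, w u) → U), Represents G T w t := by
  have e : (Σ u, Fin (w u)) ≃ Fin (∑ u, w u) := Fintype.equivFinOfCardEq (by simp)
  refine ⟨_, fun k => (e.symm k).1, fun u => ?_, rfl⟩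
  have fiberEquiv : {k // (e.symm k).1 = u} ≃ Fin (w u) :=
    (e.symm.subtypeEquiv fun _ => Iff.rfl).trans (Equiv.sigmaSubtype (β := fun u => Fin (w u)) u)
  exact (Nat.card_congr fiberEquiv).trans (Nat.card_fin _)

section Admissible

variable [Finite U] (hT : IsAdmissible T w)
include hT

theorem IsAdmissible.isIndepSet_isBlockVertex : T.IsIndepSet {u | IsBlockVertex T u} :=
  fun _ hu _ hv _ huv => (hT.isBlockVertex_iff_of_adj huv).1 hu hv

theorem IsAdmissible.isIndepSet_isBlockVertex_compl : T.IsIndepSet {u | IsBlockVertex T u}ᶜ :=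
  fun _ hu _ hv _ huv => hu ((hT.isBlockVertex_iff_of_adj huv).2 hv)

variable (h : Represents G T w t)
include h

theorem Represents.isTightLayout : IsTightLayout T {u | IsBlockVertex T u} t where
  isAcyclic := hT.isTree.isAcyclic
  isIndepSet := hT.isIndepSet_isBlockVertex
  eq_of_label_eq x y hx hxy := by
    obtain ⟨z, hz⟩ := Set.ncard_eq_one.1 ((h.ncard_fiber (t x)).trans (hT.weight_eq_one _ hx))
    exact (hz.subset rfl).trans (hz.subset hxy.symm).symm
  exists_label_eq u hu := h.exists_eq (by simp [hT.weight_eq_one u hu])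
  exists_adj u hu := by
    obtain ⟨c, hc, -⟩ := Set.not_subsingleton_iff.1 (mt IsLeaf.isBlockVertex hu)
    exact ⟨c, (hT.isBlockVertex_iff_of_adj hc.symm).2 hu, hc.symm⟩
  exists_label_eq_of_isLeaf c _ hc := h.exists_eq (Nat.one_le_iff_ne_zero.1 (hT.one_le_weight c hc))

theorem Represents.connected : G.Connected := by
  rw [h.eq_bagGraph]
  exact (h.isTightLayout hT).connected hT.isTree.connected hT.isIndepSet_isBlockVertex_compl

theorem Represents.isBlockGraph [Finite V] : IsBlockGraph G := by
  rw [h.eq_bagGraph]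
  exact isBlockGraph_of_isClique fun B hB =>
    (h.isTightLayout hT).isClique_of_isNonseparable hB.isNonseparable

theorem Represents.weightedIso [Finite V] :
    WeightedIso (blockTree G) (blockTreeWeight G) T w := by
  have ht := h.isTightLayout hT
  have hleaf : ∀ l, IsLeaf T l → IsBlockVertex T l := fun _ hl => hl.isBlockVertex
  have hC := hT.isIndepSet_isBlockVertex_compl
  obtain rfl := h.eq_bagGraph
  refine ⟨⟨ht.blockTreeEquiv hleaf hC, ht.adj_blockTreeEquiv_iff hleaf hC _ _⟩, ?_⟩
  rintro (x | B)
  · exact hT.weight_eq_one _ ((ht.isCutVertex_iff hleaf hC).1 x.2)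
  · obtain ⟨c, rfl⟩ := ht.blockEquiv.surjective B
    change w (ht.blockTreeEquiv hleaf hC (Sum.inr (ht.blockEquiv c))) =
      {x | x ∈ bag T t c ∧ ¬ IsCutVertex (bagGraph T {u | IsBlockVertex T u} t) x}.ncard
    rw [ht.blockTreeEquiv_inr, ← h.ncard_fiber]
    congr 1
    ext x
    rw [Set.mem_ofPred_eq, Set.mem_ofPred_eq, ht.isCutVertex_iff hleaf hC, not_not]
    exact ⟨fun hx => ⟨.inl hx, hx ▸ c.2⟩, fun ⟨hx, hxC⟩ => ht.label_eq_of_mem_bag c.2 hxC hx⟩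

end Admissible

end Represents

section BlockTree

variable {U V : Type*} {G : SimpleGraph V} [Finite V] {x : V}

open Classical in
/-- The label of a vertex of `G` in the block tree: a cut vertex is labelled by itself, any other
vertex by the block that contains it. -/
noncomputable def toBlockTree (G : SimpleGraph V) (x : V) : BlockTreeVertex G :=
  if hx : IsCutVertex G x then Sum.inl ⟨x, hx⟩
  else Sum.inr ⟨_, (exists_isBlock_mem G x).choose_spec.1⟩

theorem toBlockTree_eq_inl_iff {v : {v // IsCutVertex G v}} :
    toBlockTree G x = Sum.inl v ↔ x = v := by
  by_cases hx : IsCutVertex G x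
  · simp [toBlockTree, hx, Subtype.ext_iff]
  · simpa [toBlockTree, hx] using fun e : x = v => hx (e ▸ v.2)

theorem toBlockTree_eq_inr_iff {B : {S // IsBlock G S}} :
    toBlockTree G x = Sum.inr B ↔ x ∈ B.1 ∧ ¬ IsCutVertex G x := by
  by_cases hx : IsCutVertex G x
  · simp [toBlockTree, hx]
  · have hspec := (exists_isBlock_mem G x).choose_spec
    simp only [toBlockTree, hx, dite_false, Sum.inr.injEq, not_false_eq_true, and_true,
      Subtype.ext_iff]
    exact ⟨fun e => e ▸ hspec.2, hspec.1.eq_of_not_isCutVertex B.2 hx hspec.2⟩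

theorem mem_bag_toBlockTree_iff {B : {S // IsBlock G S}} :
    x ∈ bag (blockTree G) (toBlockTree G) (Sum.inr B) ↔ x ∈ B.1 := by
  by_cases hx : IsCutVertex G x
  · have hlabel : toBlockTree G x = Sum.inl ⟨x, hx⟩ := toBlockTree_eq_inl_iff.2 rfl
    simp [bag, hlabel, blockTree]
  · obtain ⟨C, hC, hxC⟩ := exists_isBlock_mem G x
    have hlabel : toBlockTree G x = Sum.inr ⟨C, hC⟩ := toBlockTree_eq_inr_iff.2 ⟨hxC, hx⟩
    simp [bag, toBlockTree_eq_inr_iff, hx, hlabel, blockTree]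

theorem represents_blockTree (hG : G.Connected) (hclique : ∀ B, IsBlock G B → G.IsClique B) :
    Represents G (blockTree G) (blockTreeWeight G) (toBlockTree G) where
  ncard_fiber a := by
    obtain v | B := a
    · simp only [toBlockTree_eq_inl_iff]
      exact Set.ncard_singleton v.1
    · simp only [toBlockTree_eq_inr_iff]
      rfl
  eq_bagGraph := by
    ext x y
    constructor
    · intro hadj
      obtain ⟨B, hB, hx, hy⟩ := exists_isBlock_of_adj hadj
      exact ⟨hadj.ne, Sum.inr ⟨B, hB⟩, (isBlockVertex_blockTree_iff hG _).2 rfl,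
        mem_bag_toBlockTree_iff.2 hx, mem_bag_toBlockTree_iff.2 hy⟩
    · rintro ⟨hne, v | B, ha, hx, hy⟩
      · exact absurd ((isBlockVertex_blockTree_iff hG _).1 ha) (by simp)
      · exact hclique B B.2 (mem_bag_toBlockTree_iff.1 hx) (mem_bag_toBlockTree_iff.1 hy) hne

theorem weightedIso_blockTree_iff [Finite U] {T : SimpleGraph U} {w : U → ℕ} (hG : G.Connected)
    (hB : IsBlockGraph G) (hT : IsAdmissible T w) :
    WeightedIso (blockTree G) (blockTreeWeight G) T w ↔ ∃ t, Represents G T w t :=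
  ⟨(represents_blockTree hG fun _ hB' =>
    hB.isClique_of_isNonseparable hB'.isNonseparable).of_weightedIso,
    fun ⟨_, ht⟩ => ht.weightedIso hT⟩

end BlockTree

section Glued

variable {U : Type*} {T : SimpleGraph U} {w : U → ℕ} (e : GluingChoice T w)

theorem mk_eq_mk_iff_glued {x y : CliqueVertex T w} :
    Quot.mk (Glued e) x = Quot.mk (Glued e) y ↔ x = y ∨ Glued e x y := by
  constructor
  · intro h
    replace h := Quot.eqvGen_exact h
    induction h with
    | rel x y h => exact .inr h
    | refl x => exact .inl rfl
    | symm x y _ ih =>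
      obtain rfl | ⟨v, hx, hy, hxv, hyv⟩ := ih
      · exact .inl rfl
      · exact .inr ⟨v, hy, hx, hyv, hxv⟩
    | trans x y z _ _ ih ih' =>
      obtain rfl | ⟨v, hx, hy, hxv, hyv⟩ := ih
      · exact ih'
      · obtain rfl | ⟨v', hy', hz, hyv', hzv'⟩ := ih'
        · exact .inr ⟨v, hx, hy, hxv, hyv⟩
        · obtain rfl : v = v' := congrArg Subtype.val ((e y.1).injective (hyv.symm.trans hyv'))
          exact .inr ⟨v, hx, hz, hxv, hzv'⟩
  · rintro (rfl | h)
    · rfl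
    · exact Quot.sound h

theorem injective_mk_glued (B : {B : U // IsBlockVertex T B}) :
    Function.Injective fun i => Quot.mk (Glued e) ⟨B, i⟩ := by
  intro i j hij
  obtain h | ⟨v, _, _, hi, hj⟩ := (mk_eq_mk_iff_glued e).1 hij
  · simpa using h
  · exact hi.trans hj.symm

/-- The vertex of `T` for which a clique vertex was chosen, or the block vertex of its clique if it
was not chosen. -/
noncomputable def cliqueLabel (x : CliqueVertex T w) : U :=
  Function.extend (e x.1) Subtype.val (fun _ => x.1.1) x.2

variable {e} {x : CliqueVertex T w} {v : U}

theorem cliqueLabel_of_mem_range (hx : x.2 ∈ Set.range (e x.1)) :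
    ∃ (v : U) (hv : T.Adj x.1.1 v), cliqueLabel e x = v ∧ x.2 = e x.1 ⟨v, hv⟩ := by
  obtain ⟨⟨v, hv⟩, hxv⟩ := hx
  refine ⟨v, hv, ?_, hxv.symm⟩
  rw [cliqueLabel, ← hxv, (e x.1).injective.extend_apply]

theorem cliqueLabel_of_notMem_range (hx : x.2 ∉ Set.range (e x.1)) : cliqueLabel e x = x.1 :=
  Function.extend_apply' _ _ _ hx

theorem cliqueLabel_eq_iff_of_adj (hv : T.Adj x.1.1 v) :
    cliqueLabel e x = v ↔ x.2 = e x.1 ⟨v, hv⟩ := by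
  by_cases hx : x.2 ∈ Set.range (e x.1)
  · obtain ⟨u, hu, hlabel, hxu⟩ := cliqueLabel_of_mem_range hx
    rw [hlabel, hxu, (e x.1).injective.eq_iff, Subtype.ext_iff]
  · rw [cliqueLabel_of_notMem_range hx]
    exact iff_of_false hv.ne fun hxv => hx ⟨_, hxv.symm⟩

theorem cliqueLabel_eq_iff_notMem_range : cliqueLabel e x = x.1 ↔ x.2 ∉ Set.range (e x.1) := by
  refine ⟨fun h hx => ?_, cliqueLabel_of_notMem_range⟩
  obtain ⟨u, hu, hlabel, -⟩ := cliqueLabel_of_mem_range hx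
  exact hu.ne (h.symm.trans hlabel)

theorem cliqueLabel_eq_or_adj (x : CliqueVertex T w) :
    cliqueLabel e x = x.1 ∨ T.Adj x.1.1 (cliqueLabel e x) := by
  by_cases hx : x.2 ∈ Set.range (e x.1)
  · obtain ⟨u, hu, hlabel, -⟩ := cliqueLabel_of_mem_range hx
    exact .inr (hlabel ▸ hu)
  · exact .inl (cliqueLabel_of_notMem_range hx)

/-- The labels of the glued graph induced by those of the clique vertices. -/
noncomputable def gluedLabel (e : GluingChoice T w) : Quot (Glued e) → U :=
  Quot.lift (cliqueLabel e) fun _ _ ⟨_, hx, hy, hxv, hyv⟩ =>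
    ((cliqueLabel_eq_iff_of_adj hx).2 hxv).trans ((cliqueLabel_eq_iff_of_adj hy).2 hyv).symm

variable [Finite U] (hT : IsAdmissible T w)
include hT

theorem bag_gluedLabel (B : {B : U // IsBlockVertex T B}) :
    bag T (gluedLabel e) B = Set.range fun i => Quot.mk (Glued e) ⟨B, i⟩ := by
  refine Set.Subset.antisymm ?_ ?_
  · intro q hq
    obtain ⟨⟨C, j⟩, rfl⟩ := Quot.exists_rep q
    obtain (hlabel : cliqueLabel e ⟨C, j⟩ = B) | (hadj : T.Adj B (cliqueLabel e ⟨C, j⟩)) := hq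
    · have hC : cliqueLabel e ⟨C, j⟩ = C := (cliqueLabel_eq_or_adj ⟨C, j⟩).resolve_right fun h =>
        (hT.isBlockVertex_iff_of_adj h).1 C.2 (hlabel ▸ B.2)
      obtain rfl : C = B := Subtype.ext (hC.symm.trans hlabel)
      exact ⟨j, rfl⟩
    · have hnot := (hT.isBlockVertex_iff_of_adj hadj).1 B.2
      have hadjC : T.Adj C (cliqueLabel e ⟨C, j⟩) :=
        (cliqueLabel_eq_or_adj ⟨C, j⟩).resolve_left fun h => hnot (h ▸ C.2)
      exact ⟨e B ⟨_, hadj⟩, Quot.sound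
        ⟨_, hadj, hadjC, rfl, (cliqueLabel_eq_iff_of_adj hadjC).1 rfl⟩⟩
  · rintro _ ⟨i, rfl⟩
    exact cliqueLabel_eq_or_adj ⟨B, i⟩

theorem ncard_gluedLabel_eq_of_isBlockVertex (B : {B : U // IsBlockVertex T B}) :
    {q | gluedLabel e q = B}.ncard = w B := by
  have himage : {q | gluedLabel e q = B} =
      (fun i => Quot.mk (Glued e) ⟨B, i⟩) '' (Set.range (e B))ᶜ := by
    ext q
    constructor
    · intro hq
      obtain ⟨i, rfl⟩ := (bag_gluedLabel hT B).subset (.inl hq)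
      exact ⟨i, (cliqueLabel_eq_iff_notMem_range (x := ⟨B, i⟩)).1 hq, rfl⟩
    · rintro ⟨i, hi, rfl⟩
      exact cliqueLabel_of_notMem_range (x := ⟨B, i⟩) hi
  rw [himage, Set.ncard_image_of_injective _ (injective_mk_glued e B), Set.ncard_compl,
    ← Set.image_univ, Set.ncard_image_of_injective _ (e B).injective, Set.ncard_univ,
    Nat.card_fin, Nat.card_coe_set_eq, Nat.add_sub_cancel]

theorem ncard_gluedLabel_eq_of_not_isBlockVertex (hv : ¬ IsBlockVertex T v) :
    {q | gluedLabel e q = v}.ncard = 1 := by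
  obtain ⟨b, hb, -⟩ := Set.not_subsingleton_iff.1 (mt IsLeaf.isBlockVertex hv)
  let B : {B : U // IsBlockVertex T B} := ⟨b, (hT.isBlockVertex_iff_of_adj hb.symm).2 hv⟩
  have hBv : T.Adj B v := hb.symm
  refine Set.ncard_eq_one.2 ⟨Quot.mk _ ⟨B, e B ⟨v, hBv⟩⟩, Set.Subset.antisymm ?_ ?_⟩
  · intro q hq
    obtain ⟨i, rfl⟩ := (bag_gluedLabel hT B).subset (.inr (hq.symm ▸ hBv))
    rw [← (cliqueLabel_eq_iff_of_adj (x := ⟨B, i⟩) hBv).1 hq]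
    rfl
  · rintro _ rfl
    exact (cliqueLabel_eq_iff_of_adj (x := ⟨B, _⟩) hBv).2 rfl

theorem represents_gluedGraph : Represents (gluedGraph e) T w (gluedLabel e) where
  ncard_fiber u := by
    by_cases hu : IsBlockVertex T u
    · exact ncard_gluedLabel_eq_of_isBlockVertex hT ⟨u, hu⟩
    · rw [hT.weight_eq_one u hu, ncard_gluedLabel_eq_of_not_isBlockVertex hT hu]
  eq_bagGraph := by
    ext x y
    refine and_congr_right fun _ => ⟨?_, ?_⟩
    · rintro ⟨B, i, j, rfl, rfl⟩
      exact ⟨B, B.2, (bag_gluedLabel hT B).superset ⟨i, rfl⟩,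
        (bag_gluedLabel hT B).superset ⟨j, rfl⟩⟩
    · rintro ⟨b, hb, hx, hy⟩
      obtain ⟨i, rfl⟩ := (bag_gluedLabel hT ⟨b, hb⟩).subset hx
      obtain ⟨j, rfl⟩ := (bag_gluedLabel hT ⟨b, hb⟩).subset hy
      exact ⟨⟨b, hb⟩, i, j, rfl, rfl⟩

end Glued

section Correspondence

theorem WeightedIso.symm {U U' : Type*} {T : SimpleGraph U} {w : U → ℕ} {T' : SimpleGraph U'}
    {w' : U' → ℕ} (h : WeightedIso T w T' w') : WeightedIso T' w' T w := by
  obtain ⟨f, hf⟩ := h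
  exact ⟨f.symm, fun v => by rw [← hf, f.apply_symm_apply]⟩

theorem WeightedIso.trans {U U' U'' : Type*} {T : SimpleGraph U} {w : U → ℕ} {T' : SimpleGraph U'}
    {w' : U' → ℕ} {T'' : SimpleGraph U''} {w'' : U'' → ℕ} (h : WeightedIso T w T' w')
    (h' : WeightedIso T' w' T'' w'') : WeightedIso T w T'' w'' := by
  obtain ⟨f, hf⟩ := h
  obtain ⟨g, hg⟩ := h'
  exact ⟨f.trans g, fun v => (hg (f v)).trans (hf v)⟩

theorem isWeightedBlockTree_iff_isAdmissible {U : Type*} [Finite U] {T : SimpleGraph U}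
    {w : U → ℕ} : IsWeightedBlockTree T w ↔ IsAdmissible T w := by
  constructor
  · rintro ⟨-, k, H, hH, h⟩
    exact (isAdmissible_blockTree hH).of_weightedIso h
  · intro h
    have := Fintype.ofFinite U
    obtain ⟨G, t, ht⟩ := exists_represents T w
    exact ⟨h.isTree, _, G, ht.connected h, ht.weightedIso h⟩

variable {n : ℕ}

theorem WeightedBlockTree.isAdmissible (T : WeightedBlockTree n) :
    IsAdmissible T.tree T.weight :=
  isWeightedBlockTree_iff_isAdmissible.1 T.isWeightedBlockTree

theorem ConnectedBlockGraph.weightedIso_iff (G : ConnectedBlockGraph n) (T : WeightedBlockTree n) :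
    WeightedIso (blockTree G.graph) (blockTreeWeight G.graph) T.tree T.weight ↔
      ∃ t, Represents G.graph T.tree T.weight t :=
  weightedIso_blockTree_iff G.connected G.isBlockGraph T.isAdmissible

theorem ConnectedBlockGraph.exists_weightedBlockTree (G : ConnectedBlockGraph n) :
    ∃ T : WeightedBlockTree n,
      WeightedIso (blockTree G.graph) (blockTreeWeight G.graph) T.tree T.weight := by
  let φ := Finite.equivFin (BlockTreeVertex G.graph)
  have hiso : WeightedIso (blockTree G.graph) (blockTreeWeight G.graph)
      ((blockTree G.graph).map φ.toEmbedding) (blockTreeWeight G.graph ∘ φ.symm) :=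
    ⟨SimpleGraph.Iso.map φ _, fun v => congrArg _ (φ.symm_apply_apply v)⟩
  have hadm := (isAdmissible_blockTree G.connected).of_weightedIso hiso
  obtain ⟨t, ht⟩ := (weightedIso_blockTree_iff G.connected G.isBlockGraph hadm).1 hiso
  exact ⟨⟨_, _, _, isWeightedBlockTree_iff_isAdmissible.2 hadm,
    by rw [← ht.card_eq, Nat.card_fin]⟩, hiso⟩

theorem WeightedBlockTree.exists_connectedBlockGraph (T : WeightedBlockTree n) :
    ∃ G : ConnectedBlockGraph n,
      WeightedIso (blockTree G.graph) (blockTreeWeight G.graph) T.tree T.weight := by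
  have hT := T.isAdmissible
  obtain ⟨m, T, w, h, rfl⟩ := T
  obtain ⟨G, t, ht⟩ := exists_represents T w
  exact ⟨⟨G, ht.connected hT, ht.isBlockGraph hT⟩, ht.weightedIso hT⟩

theorem ConnectedBlockGraph.nonempty_iso_iff {G G' : ConnectedBlockGraph n}
    {T T' : WeightedBlockTree n}
    (hG : WeightedIso (blockTree G.graph) (blockTreeWeight G.graph) T.tree T.weight)
    (hG' : WeightedIso (blockTree G'.graph) (blockTreeWeight G'.graph) T'.tree T'.weight) :
    Nonempty (G.graph ≃g G'.graph) ↔ WeightedIso T.tree T.weight T'.tree T'.weight := by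
  obtain ⟨t', ht'⟩ := (G'.weightedIso_iff T').1 hG'
  constructor
  · rintro ⟨f⟩
    exact hG.symm.trans ((G.weightedIso_iff T').2 ⟨_, ht'.comp_iso f⟩)
  · intro h
    obtain ⟨t, ht⟩ := (G.weightedIso_iff T').1 (hG.trans h)
    exact ht.nonempty_iso ht'

theorem exists_equiv_classes (n : ℕ) :
    ∃ Φ : ConnectedBlockGraphClass n ≃ WeightedBlockTreeClass n,
      ∀ (G : ConnectedBlockGraph n) (T : WeightedBlockTree n),
        Φ (Quotient.mk _ G) = Quotient.mk _ T ↔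
          WeightedIso (blockTree G.graph) (blockTreeWeight G.graph) T.tree T.weight := by
  choose bcw hbcw using ConnectedBlockGraph.exists_weightedBlockTree (n := n)
  let F : ConnectedBlockGraphClass n → WeightedBlockTreeClass n :=
    Quotient.map bcw fun G G' => (ConnectedBlockGraph.nonempty_iso_iff (hbcw G) (hbcw G')).1
  have mk_eq_iff : ∀ G T, F (Quotient.mk _ G) = Quotient.mk _ T ↔
      WeightedIso (blockTree G.graph) (blockTreeWeight G.graph) T.tree T.weight := fun G T =>
    Quotient.eq.trans ⟨(hbcw G).trans, (hbcw G).symm.trans⟩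
  have injective_F : Function.Injective F := by
    rintro ⟨G⟩ ⟨G'⟩ h
    exact Quotient.sound
      ((ConnectedBlockGraph.nonempty_iso_iff (hbcw G) (hbcw G')).2 (Quotient.exact h))
  have surjective_F : Function.Surjective F := by
    rintro ⟨T⟩
    obtain ⟨G, hG⟩ := T.exists_connectedBlockGraph
    exact ⟨Quotient.mk _ G, (mk_eq_iff G T).2 hG⟩
  exact ⟨.ofBijective F ⟨injective_F, surjective_F⟩, mk_eq_iff⟩

end Correspondence

end BlockGraphs

theorem mainTheorem2 :
    -- the one-to-one correspondence, up to isomorphism, and its inverse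
    (∀ n : ℕ, ∃ Φ : BlockGraphs.ConnectedBlockGraphClass n ≃ BlockGraphs.WeightedBlockTreeClass n,
      (∀ (G : BlockGraphs.ConnectedBlockGraph n) (T : BlockGraphs.WeightedBlockTree n),
        Φ (Quotient.mk _ G) = Quotient.mk _ T ↔
          BlockGraphs.WeightedIso (BlockGraphs.blockTree G.graph)
            (BlockGraphs.blockTreeWeight G.graph) T.tree T.weight) ∧
      (∀ (T : BlockGraphs.WeightedBlockTree n)
        (e : BlockGraphs.GluingChoice T.tree T.weight) (G : BlockGraphs.ConnectedBlockGraph n),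
        Φ.symm (Quotient.mk _ T) = Quotient.mk _ G ↔
          Nonempty (G.graph ≃g BlockGraphs.gluedGraph e))) ∧
    -- which weighted trees are weighted block trees
    (∀ (m : ℕ) (T : SimpleGraph (Fin m)) (w : Fin m → ℕ),
      BlockGraphs.IsWeightedBlockTree T w ↔
        T.IsTree ∧
        (∀ l l' : Fin m, BlockGraphs.IsLeaf T l → BlockGraphs.IsLeaf T l' → Even (T.dist l l')) ∧
        (∀ v : Fin m, ¬ BlockGraphs.IsBlockVertex T v → w v = 1) ∧
        (∀ l : Fin m, BlockGraphs.IsLeaf T l → 1 ≤ w l)) := by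
  refine ⟨fun n => ?_, fun m T w =>
    BlockGraphs.isWeightedBlockTree_iff_isAdmissible.trans BlockGraphs.isAdmissible_iff⟩
  obtain ⟨Φ, hΦ⟩ := BlockGraphs.exists_equiv_classes n
  refine ⟨Φ, hΦ, fun T e G => ?_⟩
  rw [Equiv.symm_apply_eq, eq_comm, hΦ, G.weightedIso_iff]
  have hglued : BlockGraphs.Represents (BlockGraphs.gluedGraph e) T.tree T.weight _ :=
    BlockGraphs.represents_gluedGraph T.isAdmissible
  exact ⟨fun ⟨_, ht⟩ => ht.nonempty_iso hglued, fun ⟨f⟩ => ⟨_, hglued.comp_iso f⟩⟩
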